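/- Let $n\ge 2$. Let $NC_{n+1}$ be the set of noncrossing partitions of $\{1,\dots,n+1\}$, ordered by refinement. If $\tau$ covers $\sigma$ in $NC_{n+1}$, then a block $B$ of $\tau$ is the union of two blocks $B_1, B_2$ of $\sigma$, where $\min B\in B_1$; label this covering relation by the largest element of $B_1$ that is smaller than all elements of $B_2$. Reading the labels from bottom to top identifies the maximal chains of $NC_{n+1}$ with the parking functions of length $n$, i.e. the $n$-tuples of positive integers whose weakly increasing rearrangement $b_1\le\dots\le b_n$ satisfies $b_i\le i$ for all $i$. Let $PF_{n,n}$ be the set of parking functions of length $n$ in which the number $n$ does not occur, and let $\mathrm{Poset}(PF_{n,n})$ be the poset whose Hasse diagram is the union of the maximal chains of $NC_{n+1}$ that correspond to the elements of $PF_{n,n}$: its elements are the noncrossing partitions lying on such a chain, and $\sigma\le\tau$ if and only if $\tau$ can be reached from $\sigma$ by going up along edges of such chains. **Theorem.** The identity map is the unique order-preserving automorphism of $\mathrm{Poset}(PF_{n,n})$; that is, every order isomorphism from $\mathrm{Poset}(PF_{n,n})$ to itself is the identity. -/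

import Mathlib

namespace ParkingPoset

/-- A parking function of length `n`: a tuple of positive integers whose weakly increasing
rearrangement has its `i`-th entry at most `i` for `i = 1, …, n`.
The index `i : Fin n` stands for position `i + 1`. -/
def IsParkingFunction {n : ℕ} (a : Fin n → ℕ) : Prop :=
  (∀ i, 1 ≤ a i) ∧
    ∃ σ : Equiv.Perm (Fin n), Monotone (fun i => a (σ i)) ∧ ∀ i : Fin n, a (σ i) ≤ (i : ℕ) + 1

/-- The set `PF_{n,k}` of parking functions of length `n` whose largest missing number in
`{1, …, n}` is `k`: the value `k` does not occur, and `k + 1, …, n` all occur. -/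
def PF (n k : ℕ) : Set (Fin n → ℕ) :=
  {a | IsParkingFunction a ∧ (∀ i, a i ≠ k) ∧ ∀ m, k < m → m ≤ n → ∃ i, a i = m}

/-- A partition (equivalence relation) is noncrossing if there are no `a < b < c < d` such that
`a, c` lie in one block and `b, d` lie in a different block. -/
def Noncrossing {m : ℕ} (π : Setoid (Fin m)) : Prop :=
  ∀ a b c d : Fin m, a < b → b < c → c < d → π a c → π b d → π a b

/-- The noncrossing partitions of `{1, …, m}`, where `i : Fin m` stands for the number `i + 1`. -/
def NC (m : ℕ) : Type := {π : Setoid (Fin m) // Noncrossing π}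

/-- The refinement order: `σ ≤ τ` iff every block of `σ` is contained in a block of `τ`. -/
instance (m : ℕ) : PartialOrder (NC m) :=
  inferInstanceAs (PartialOrder {π : Setoid (Fin m) // Noncrossing π})

/-- `IsEdgeLabel σ τ l`: the partition `τ` has a block `B₁ ∪ B₂` that is the union of two
different blocks `B₁`, `B₂` of `σ`, where `B₁` contains the minimum of `B₁ ∪ B₂`, and `l` is the
largest number in `B₁` that is smaller than all elements of `B₂`. For a covering relation
`σ ⋖ τ` there is exactly one such `l`, the label of the covering relation. -/
def IsEdgeLabel {m : ℕ} (σ τ : NC m) (l : ℕ) : Prop :=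
  ∃ B₁ B₂ : Set (Fin m), B₁ ∈ σ.1.classes ∧ B₂ ∈ σ.1.classes ∧ B₁ ≠ B₂ ∧
    B₁ ∪ B₂ ∈ τ.1.classes ∧
    (∃ b ∈ B₁, IsLeast (B₁ ∪ B₂) b) ∧
    ∃ x : Fin m, IsGreatest {y | y ∈ B₁ ∧ ∀ z ∈ B₂, y < z} x ∧ l = (x : ℕ) + 1

/-- The maximal chains of `NC_{n+1}`: paths from the bottom to the top of its Hasse diagram. -/
def IsMaximalChain {n : ℕ} (c : Fin (n + 1) → NC (n + 1)) : Prop :=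
  (c 0).1 = ⊥ ∧ (c (Fin.last n)).1 = ⊤ ∧ ∀ i : Fin n, c i.castSucc ⋖ c i.succ

/-- The maximal chains of `NC_{n+1}` that correspond to the elements of `PF_{n,k}`: those whose
sequence of labels, read from bottom to top, lies in `PF_{n,k}`. -/
def IsPFChain (n k : ℕ) (c : Fin (n + 1) → NC (n + 1)) : Prop :=
  IsMaximalChain c ∧ ∃ a ∈ PF n k, ∀ i : Fin n, IsEdgeLabel (c i.castSucc) (c i.succ) (a i)

/-- The edges of the union of the chains that correspond to `PF_{n,k}`. -/
def HasseEdge (n k : ℕ) (σ τ : NC (n + 1)) : Prop :=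
  ∃ c, IsPFChain n k c ∧ ∃ i : Fin n, c i.castSucc = σ ∧ c i.succ = τ

/-- The underlying set of `Poset(PF_{n,k})`: the noncrossing partitions lying on one of the
maximal chains of `NC_{n+1}` that correspond to `PF_{n,k}`. -/
def PosetPF (n k : ℕ) : Type :=
  {π : NC (n + 1) // ∃ c, IsPFChain n k c ∧ ∃ i, c i = π}

theorem HasseEdge.covBy {n k : ℕ} {σ τ : NC (n + 1)} (h : HasseEdge n k σ τ) : σ ⋖ τ := by
  obtain ⟨c, hc, i, rfl, rfl⟩ := h
  exact hc.1.2.2 i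

theorem le_of_reflTransGen {n k : ℕ} {σ τ : NC (n + 1)}
    (h : Relation.ReflTransGen (HasseEdge n k) σ τ) : σ ≤ τ := by
  induction h with
  | refl => exact le_rfl
  | tail _ h ih => exact ih.trans h.covBy.le

/-- The order of `Poset(PF_{n,k})` is the one whose Hasse diagram is the union of the chains:
`σ ≤ τ` iff one can go up from `σ` to `τ` along edges of these chains. (It is in general not the
order induced from `NC_{n+1}`.) -/
instance (n k : ℕ) : PartialOrder (PosetPF n k) where
  le σ τ := Relation.ReflTransGen (HasseEdge n k) σ.1 τ.1
  le_refl _ := Relation.ReflTransGen.refl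
  le_trans _ _ _ h₁ h₂ := Relation.ReflTransGen.trans h₁ h₂
  le_antisymm _ _ h₁ h₂ :=
    Subtype.ext (le_antisymm (le_of_reflTransGen h₁) (le_of_reflTransGen h₂))

end ParkingPoset

/-!
The set of labels of a maximal chain of `NC_{n+1}` is controlled by block minima: a covering
relation `σ ⋖ τ` unites the blocks of two block minima `x < y`, so that `y` ceases to be a block
minimum, and its label is smaller than `y` (`NC.exists_label`). Along a maximal chain every number
except `1` ceases to be a block minimum exactly once, so the label sequence is always a parking
function, and the only condition left in `PF_{n,n}` is that no label is `n`. The label is `n`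
precisely when `n + 1`, until then a singleton block, is joined to the block of `n`. Thus
`Poset(PF_{n,n})` is the poset of all paths of such allowed edges: its elements are the
noncrossing partitions in which `1` is joined to `n` only if `n + 1` is as well, and in which
`{n, n + 1}` is not a block (`mem_posetPF_iff_rel`), and a refinement `σ ≤ τ` can be followed by
allowed edges unless `n + 1` is a singleton in `σ` and joined to `n` in `τ` (`reflTransGen_of_le`,
`exists_between`).

This makes rigidity visible. For `i < n` the element with the block `{i, n, n + 1}` covers only
the atom `{i, n + 1}`, since the edge from `{i, n}` has label `n` and `{n, n + 1}` does not
belong to the poset; no other element covers exactly one atom and nothing else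
(`exists_of_isStem`). So an automorphism permutes these pairs of elements. It also respects the
order of the indices `i`, because `i < i'` can be expressed by upper bounds (`stemLT_iff`), where
the witness for `i < i'` is the atom `{i', n}`. An order-preserving permutation of a finite chain
is the identity, so these elements are fixed (`map_stem`). The other atoms `{i, j}` are then
determined by their common upper bounds with the atoms `{k, n + 1}` (`map_pair`,
`map_pair_penult`), and finally every element `y` is determined by the elements of the forms
`{i, n + 1}`, `{i, n, n + 1}` and `{i, j}` that lie below it (`val_le_map`).

In the code the numbers `1`, `n` and `n + 1` are `0`, `penult n` and `Fin.last n` in `Fin (n + 1)`.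
-/

namespace ParkingPoset

open Relation

/-! ### Noncrossing partitions -/

namespace NC

variable {m : ℕ}

theorem le_iff {σ τ : NC m} : σ ≤ τ ↔ ∀ x y, σ.1 x y → τ.1 x y := Iff.rfl

theorem ext_iff' {σ τ : NC m} : σ = τ ↔ ∀ x y, σ.1 x y ↔ τ.1 x y :=
  ⟨fun h _ _ => h ▸ Iff.rfl, fun h =>
    le_antisymm (fun x y => (h x y).1) (fun x y => (h x y).2)⟩

instance : Finite (NC m) :=
  Finite.of_injective (fun (σ : NC m) (x y : Fin m) => σ.1 x y) fun σ τ h =>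
    ext_iff'.2 fun x y => by
      have := congrFun (congrFun h x) y
      exact iff_of_eq this

instance : OrderBot (NC m) where
  bot := ⟨⊥, fun a b c d hab hbc _ hac _ => by
    have : a = c := hac
    omega⟩
  bot_le σ := le_iff.2 fun x y h => by
    have : x = y := h
    exact this ▸ σ.1.refl x

instance : OrderTop (NC m) where
  top := ⟨⊤, fun _ _ _ _ _ _ _ _ _ => trivial⟩
  le_top _ := le_iff.2 fun _ _ _ => trivial

theorem bot_rel {x y : Fin m} : (⊥ : NC m).1 x y ↔ x = y := Iff.rfl

theorem top_rel (x y : Fin m) : (⊤ : NC m).1 x y := trivial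

theorem eq_bot_iff_val {σ : NC m} : σ.1 = ⊥ ↔ σ = ⊥ :=
  ⟨fun h => Subtype.ext h, fun h => h ▸ rfl⟩

theorem eq_top_iff_val {σ : NC m} : σ.1 = ⊤ ↔ σ = ⊤ :=
  ⟨fun h => Subtype.ext h, fun h => h ▸ rfl⟩

/-- The noncrossing partition obtained from `σ` by turning all elements outside `S` into
singleton blocks. -/
def restrict (σ : NC m) (S : Set (Fin m)) : NC m :=
  ⟨{ r := fun x y => x = y ∨ (x ∈ S ∧ y ∈ S ∧ σ.1 x y)
     iseqv :=
      { refl := fun x => Or.inl rfl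
        symm := by
          rintro x y (rfl | ⟨hx, hy, h⟩)
          · exact Or.inl rfl
          · exact Or.inr ⟨hy, hx, σ.1.symm h⟩
        trans := by
          rintro x y z (rfl | ⟨hx, hy, h⟩) (rfl | ⟨hy', hz, h'⟩)
          · exact Or.inl rfl
          · exact Or.inr ⟨hy', hz, h'⟩
          · exact Or.inr ⟨hx, hy, h⟩
          · exact Or.inr ⟨hx, hz, σ.1.trans h h'⟩ } }, by
    rintro a b c d hab hbc hcd (rfl | ⟨ha, hc, hac⟩) (rfl | ⟨hb, hd, hbd⟩)
    · omega
    · omega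
    · omega
    · exact Or.inr ⟨ha, hb, σ.2 a b c d hab hbc hcd hac hbd⟩⟩

theorem restrict_rel {σ : NC m} {S : Set (Fin m)} {x y : Fin m} :
    (σ.restrict S).1 x y ↔ x = y ∨ (x ∈ S ∧ y ∈ S ∧ σ.1 x y) := Iff.rfl

theorem restrict_le (σ : NC m) (S : Set (Fin m)) : σ.restrict S ≤ σ :=
  le_iff.2 fun x y h => by
    rcases restrict_rel.1 h with rfl | h
    · exact σ.1.refl x
    · exact h.2.2

/-- The noncrossing partition all of whose blocks, except possibly `S`, are singletons. -/
def block (S : Set (Fin m)) : NC m := restrict ⊤ S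

theorem block_rel {S : Set (Fin m)} {x y : Fin m} :
    (block S).1 x y ↔ x = y ∨ (x ∈ S ∧ y ∈ S) :=
  ⟨fun h => h.imp_right fun h => ⟨h.1, h.2.1⟩, fun h => h.imp_right fun h => ⟨h.1, h.2, trivial⟩⟩

theorem block_le {S : Set (Fin m)} {σ : NC m} :
    block S ≤ σ ↔ ∀ x ∈ S, ∀ y ∈ S, σ.1 x y := by
  refine ⟨fun h x hx y hy => h (block_rel.2 (Or.inr ⟨hx, hy⟩)), fun h => le_iff.2 fun x y hxy => ?_⟩
  rcases block_rel.1 hxy with rfl | ⟨hx, hy⟩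
  · exact σ.1.refl x
  · exact h x hx y hy

theorem block_pair_le {i j : Fin m} {σ : NC m} : block {i, j} ≤ σ ↔ σ.1 i j := by
  rw [block_le]
  constructor
  · intro h
    exact h i (by simp) j (by simp)
  · rintro h x (rfl | rfl) y (rfl | rfl)
    exacts [σ.1.refl _, h, σ.1.symm h, σ.1.refl _]

/-- The non-minimal elements of the blocks of `σ`. There are `m` minus the number of blocks of
them, so that their number is the rank of `σ`. -/
def nonMin (σ : NC m) : Set (Fin m) := {x | ∃ y < x, σ.1 y x}

theorem nonMin_mono {σ τ : NC m} (h : σ ≤ τ) : σ.nonMin ⊆ τ.nonMin :=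
  fun _ ⟨y, hy, hr⟩ => ⟨y, hy, h hr⟩

/-- The rank of a noncrossing partition. -/
noncomputable def rank (σ : NC m) : ℕ := σ.nonMin.ncard

theorem rank_bot : (⊥ : NC m).rank = 0 := by
  have : (⊥ : NC m).nonMin = ∅ := by
    ext x
    simp only [nonMin, bot_rel, Set.mem_ofPred_eq, Set.mem_empty_iff_false, iff_false]
    rintro ⟨y, hy, rfl⟩
    omega
  rw [rank, this, Set.ncard_empty]

theorem rank_top {n : ℕ} : (⊤ : NC (n + 1)).rank = n := by
  have : (⊤ : NC (n + 1)).nonMin = {0}ᶜ := by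
    ext x
    simp only [nonMin, Set.mem_ofPred_eq, Set.mem_compl_iff, Set.mem_singleton_iff]
    constructor
    · rintro ⟨y, hy, -⟩ rfl
      exact absurd hy (Fin.not_lt_zero y)
    · intro hx
      exact ⟨0, Fin.pos_of_ne_zero hx, trivial⟩
  rw [rank, this, Set.ncard_compl, Set.ncard_singleton, Nat.card_eq_fintype_card, Fintype.card_fin]
  rfl

/-! ### Covering relations and their labels -/

/-- If `x < y` lie in the same block of `τ`, with no element of that block in between, then the
partition obtained from `σ ≤ τ` by uniting the blocks of `x` and `y` is noncrossing. -/
theorem exists_merge {σ τ : NC m} (hle : σ ≤ τ) {x y : Fin m} (hxy : x < y) (hτ : τ.1 x y)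
    (hσ : ¬ σ.1 x y) (hgap : ∀ t, x < t → t < y → ¬ τ.1 x t) :
    ∃ ρ : NC m, ∀ u v, ρ.1 u v ↔
      σ.1 u v ∨ (σ.1 u x ∧ σ.1 v y) ∨ (σ.1 u y ∧ σ.1 v x) := by
  have R := σ.1.refl
  have S : ∀ {a b}, σ.1 a b → σ.1 b a := σ.1.symm
  have T : ∀ {a b c}, σ.1 a b → σ.1 b c → σ.1 a c := σ.1.trans
  have S' : ∀ {a b}, τ.1 a b → τ.1 b a := τ.1.symm
  have T' : ∀ {a b c}, τ.1 a b → τ.1 b c → τ.1 a c := τ.1.trans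
  -- a chord of `σ` that separates elements of the two united blocks is in one of these blocks
  have key : ∀ q s i o : Fin m, q < i → i < s → (o < q ∨ s < o) →
      (σ.1 i x ∧ σ.1 o y ∨ σ.1 i y ∧ σ.1 o x) → σ.1 q s → σ.1 q x ∨ σ.1 q y := by
    intro q s i o hqi his ho hio hqs
    by_contra hcon
    push Not at hcon
    have hτio : τ.1 i o := by
      rcases hio with ⟨h1, h2⟩ | ⟨h1, h2⟩
      · exact T' (T' (hle h1) hτ) (S' (hle h2))
      · exact T' (T' (hle h1) (S' hτ)) (S' (hle h2))
    have hτqi : τ.1 q i := by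
      rcases ho with ho | ho
      · exact S' (T' hτio (τ.2 o q i s ho hqi his (S' hτio) (hle hqs)))
      · exact τ.2 q i s o hqi his ho (hle hqs) hτio
    have hxq : τ.1 x q := by
      rcases hio with h | h
      · exact S' (T' hτqi (hle h.1))
      · exact T' hτ (S' (T' hτqi (hle h.1)))
    have hside : ∀ t, τ.1 x t → ¬ σ.1 t x → ¬ σ.1 t y → t < x ∨ y < t := by
      intro t h1 h2 h3
      by_contra! h
      rcases h.1.eq_or_lt with rfl | h4
      · exact h2 (R _)
      · rcases h.2.eq_or_lt with rfl | h5
        · exact h3 (R _)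
        · exact hgap t h4 h5 h1
    -- `x` and `y` lie on the same side of the chord from `q` to `s`
    have hq' := hside q hxq hcon.1 hcon.2
    have hs' := hside s (T' hxq (hle hqs)) (fun h => hcon.1 (T hqs h)) fun h => hcon.2 (T hqs h)
    have hin : ∀ w, σ.1 o w → q < w → w < s → σ.1 q w := fun w hw h1 h2 => by
      rcases ho with ho | ho
      · exact T (S (σ.2 o q w s ho h1 h2 hw hqs)) hw
      · exact σ.2 q w s o h1 h2 ho hqs (S hw)
    have hout : ∀ w, σ.1 i w → (w < q ∨ s < w) → σ.1 q w := fun w hw h => by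
      rcases h with h | h
      · exact S (σ.2 w q i s h hqi his (S hw) hqs)
      · exact T (σ.2 q i s w hqi his h hqs hw) hw
    rcases hq' with hq' | hq'
    · rcases hs' with hs' | hs'
      · rcases hio with h | h
        · exact hcon.1 (hout x h.1 (Or.inr hs'))
        · exact hcon.2 (hout y h.1 (Or.inr (hs'.trans hxy)))
      · rcases hio with h | h
        · exact hcon.2 (hin y h.2 (hq'.trans hxy) hs')
        · exact hcon.1 (hin x h.2 hq' (hxy.trans hs'))
    · rcases hio with h | h
      · exact hcon.1 (hout x h.1 (Or.inl (hxy.trans hq')))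
      · exact hcon.2 (hout y h.1 (Or.inl hq'))
  refine ⟨⟨⟨fun u v => σ.1 u v ∨ (σ.1 u x ∧ σ.1 v y) ∨ (σ.1 u y ∧ σ.1 v x), ?_, ?_, ?_⟩, ?_⟩,
    fun _ _ => Iff.rfl⟩
  · exact fun u => Or.inl (R u)
  · rintro u v (h | h | h)
    · exact Or.inl (S h)
    · exact Or.inr (Or.inr h.symm)
    · exact Or.inr (Or.inl h.symm)
  · rintro u v w (h | h | h) (h' | h' | h')
    · exact Or.inl (T h h')
    · exact Or.inr (Or.inl ⟨T h h'.1, h'.2⟩)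
    · exact Or.inr (Or.inr ⟨T h h'.1, h'.2⟩)
    · exact Or.inr (Or.inl ⟨h.1, T (S h') h.2⟩)
    · exact Or.inr (Or.inl ⟨h.1, h'.2⟩)
    · exact Or.inl (T h.1 (S h'.2))
    · exact Or.inr (Or.inr ⟨h.1, T (S h') h.2⟩)
    · exact Or.inl (T h.1 (S h'.2))
    · exact Or.inr (Or.inr ⟨h.1, h'.2⟩)
  · intro a b c d hab hbc hcd hac hbd
    change σ.1 a b ∨ (σ.1 a x ∧ σ.1 b y) ∨ (σ.1 a y ∧ σ.1 b x)
    change σ.1 a c ∨ (σ.1 a x ∧ σ.1 c y) ∨ (σ.1 a y ∧ σ.1 c x) at hac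
    change σ.1 b d ∨ (σ.1 b x ∧ σ.1 d y) ∨ (σ.1 b y ∧ σ.1 d x) at hbd
    rcases hac with hac | hac
    · rcases hbd with hbd | hbd
      · exact Or.inl (σ.2 a b c d hab hbc hcd hac hbd)
      · rcases key a c b d hab hbc (Or.inr hcd) hbd hac with h | h
        · rcases hbd with h' | h'
          · exact Or.inl (T h (S h'.1))
          · exact Or.inr (Or.inl ⟨h, h'.1⟩)
        · rcases hbd with h' | h'
          · exact Or.inr (Or.inr ⟨h, h'.1⟩)
          · exact Or.inl (T h (S h'.1))
    · have hb : σ.1 b x ∨ σ.1 b y := by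
        rcases hbd with hbd | hbd | hbd
        · exact key b d c a hbc hcd (Or.inl hab) (by tauto) hbd
        · exact Or.inl hbd.1
        · exact Or.inr hbd.1
      rcases hac with h | h <;> rcases hb with h' | h'
      · exact Or.inl (T h.1 (S h'))
      · exact Or.inr (Or.inl ⟨h.1, h'⟩)
      · exact Or.inr (Or.inr ⟨h.1, h'⟩)
      · exact Or.inl (T h.1 (S h'))

theorem exists_min_class (σ : NC m) (x : Fin m) : ∃ y, σ.1 x y ∧ ∀ z, σ.1 x z → y ≤ z := by
  obtain ⟨y, hy⟩ := (Set.toFinite {y | σ.1 x y}).exists_minimal ⟨x, σ.1.refl x⟩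
  exact ⟨y, hy.1, fun z hz => by
    by_contra h
    exact h (hy.2 hz (le_of_not_ge h))⟩

/-- A covering relation unites the blocks of two block minima `x < y`. -/
theorem exists_of_covBy {σ τ : NC m} (h : σ ⋖ τ) : ∃ x y : Fin m, x < y ∧ ¬ σ.1 x y ∧
    (∀ z, σ.1 x z → x ≤ z) ∧ (∀ z, σ.1 y z → y ≤ z) ∧
    ∀ u v, τ.1 u v ↔ σ.1 u v ∨ (σ.1 u x ∧ σ.1 v y) ∨ (σ.1 u y ∧ σ.1 v x) := by
  have hle : σ ≤ τ := h.le
  have S : ∀ {a b}, σ.1 a b → σ.1 b a := σ.1.symm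
  have T : ∀ {a b c}, σ.1 a b → σ.1 b c → σ.1 a c := σ.1.trans
  -- a pair of elements at minimal distance that is in `τ` but not in `σ`
  have hex : ∃ d : ℕ, ∃ x y : Fin m, x < y ∧ τ.1 x y ∧ ¬ σ.1 x y ∧ (y : ℕ) - x = d := by
    have : ¬ τ ≤ σ := h.lt.not_ge
    rw [le_iff] at this
    push Not at this
    obtain ⟨x, y, h1, h2⟩ := this
    rcases lt_trichotomy x y with hlt | rfl | hlt
    · exact ⟨_, x, y, hlt, h1, h2, rfl⟩
    · exact absurd (σ.1.refl _) h2
    · exact ⟨_, y, x, hlt, τ.1.symm h1, fun h => h2 (S h), rfl⟩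
  classical
  obtain ⟨x, y, hxy, hτ, hσ, hd⟩ := Nat.find_spec hex
  have hmin : ∀ x' y' : Fin m, x' < y' → τ.1 x' y' → (y' : ℕ) - x' < y - x → σ.1 x' y' := by
    intro x' y' h1 h2 h3
    by_contra h4
    exact Nat.find_min hex (hd ▸ h3) ⟨x', y', h1, h2, h4, rfl⟩
  obtain ⟨ρ, hρ⟩ := exists_merge hle hxy hτ hσ (by
    intro t h1 h2 h3
    have h4 := hmin x t h1 h3 (by omega)
    have h5 := hmin t y h2 (τ.1.trans (τ.1.symm h3) hτ) (by omega)
    exact hσ (T h4 h5))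
  have hρτ : ρ = τ := by
    have h1 : σ < ρ := by
      refine lt_of_le_not_ge (le_iff.2 fun u v h => (hρ u v).2 (Or.inl h)) fun hge => hσ ?_
      exact hge ((hρ x y).2 (Or.inr (Or.inl ⟨σ.1.refl x, σ.1.refl y⟩)))
    have h2 : ρ ≤ τ := le_iff.2 fun u v h => by
      rcases (hρ u v).1 h with h | h | h
      · exact hle h
      · exact τ.1.trans (τ.1.trans (hle h.1) hτ) (τ.1.symm (hle h.2))
      · exact τ.1.trans (τ.1.trans (hle h.1) (τ.1.symm hτ)) (τ.1.symm (hle h.2))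
    exact h2.eq_of_not_lt fun h3 => h.2 h1 h3
  subst hρτ
  obtain ⟨x', hx', hxm⟩ := σ.exists_min_class x
  obtain ⟨y', hy', hym⟩ := σ.exists_min_class y
  have e1 : ∀ u, σ.1 u x ↔ σ.1 u x' := fun u => ⟨fun h => T h hx', fun h => T h (S hx')⟩
  have e2 : ∀ u, σ.1 u y ↔ σ.1 u y' := fun u => ⟨fun h => T h hy', fun h => T h (S hy')⟩
  have hn : ¬ σ.1 x' y' := fun h => hσ (T hx' (T h (S hy')))
  rcases lt_trichotomy x' y' with hlt | heq | hlt
  · refine ⟨x', y', hlt, hn, fun z hz => hxm z (T hx' hz), fun z hz => hym z (T hy' hz), ?_⟩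
    intro u v
    rw [hρ, e1, e2, e1, e2]
  · exact absurd (heq ▸ σ.1.refl _) hn
  · refine ⟨y', x', hlt, fun h => hn (S h), fun z hz => hym z (T hy' hz),
      fun z hz => hxm z (T hx' hz), ?_⟩
    intro u v
    rw [hρ, e1, e2, e1, e2]
    tauto

/-- A covering relation makes exactly one block minimum `y` non-minimal, and has a label that is
at most the number of elements smaller than `y`. -/
theorem exists_label {σ τ : NC m} (h : σ ⋖ τ) : ∃ (y : Fin m) (l : ℕ), y ∉ σ.nonMin ∧
    τ.nonMin = insert y σ.nonMin ∧ IsEdgeLabel σ τ l ∧ 1 ≤ l ∧ l ≤ y := by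
  obtain ⟨x, y, hxy, hn, hx, hy, hτ⟩ := exists_of_covBy h
  have R := σ.1.refl
  have S : ∀ {a b}, σ.1 a b → σ.1 b a := σ.1.symm
  have T : ∀ {a b c}, σ.1 a b → σ.1 b c → σ.1 a c := σ.1.trans
  obtain ⟨g, hg⟩ := (Set.toFinite {t | σ.1 t x ∧ t < y}).exists_maximal ⟨x, R x, hxy⟩
  have hg' : ∀ t, σ.1 t x → t < y → t ≤ g := fun t h1 h2 => by
    by_contra h3
    exact h3 (hg.2 ⟨h1, h2⟩ (le_of_not_ge h3))
  refine ⟨y, g + 1, ?_, ?_, ?_, by omega, ?_⟩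
  · rintro ⟨z, hz, hzy⟩
    exact absurd (hy z (S hzy)) (not_le.2 hz)
  · ext u
    simp only [nonMin, Set.mem_ofPred_eq, Set.mem_insert_iff]
    constructor
    · rintro ⟨v, hvu, hv⟩
      rcases (hτ v u).1 hv with h1 | h1 | h1
      · exact Or.inr ⟨v, hvu, h1⟩
      · rcases (hy u (S h1.2)).eq_or_lt with h2 | h2
        · exact Or.inl h2.symm
        · exact Or.inr ⟨y, h2, S h1.2⟩
      · exact Or.inr ⟨x, hxy.trans ((hy v (S h1.1)).trans_lt hvu), S h1.2⟩
    · rintro (rfl | ⟨v, h1, h2⟩)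
      · exact ⟨x, hxy, (hτ _ _).2 (Or.inr (Or.inl ⟨R x, R _⟩))⟩
      · exact ⟨v, h1, h.le h2⟩
  · refine ⟨{u | σ.1 u x}, {u | σ.1 u y}, ⟨x, rfl⟩, ⟨y, rfl⟩, ?_, ⟨x, ?_⟩, ?_, g, ?_, rfl⟩
    · intro heq
      have : x ∈ {u | σ.1 u y} := heq ▸ R x
      exact hn this
    · ext u
      simp only [Set.mem_union, Set.mem_ofPred_eq]
      rw [show (τ.1 u x ↔ _) from hτ u x]
      constructor
      · rintro (h1 | h1)
        · exact Or.inl h1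
        · exact Or.inr (Or.inr ⟨h1, R x⟩)
      · rintro (h1 | h1 | h1)
        · exact Or.inl h1
        · exact Or.inl h1.1
        · exact Or.inr h1.1
    · refine ⟨x, R x, Or.inl (R x), ?_⟩
      rintro z (hz | hz)
      · exact hx z (S hz)
      · exact hxy.le.trans (hy z (S hz))
    · exact ⟨⟨hg.1.1, fun z hz => hg.1.2.trans_le (hy z (S hz))⟩,
        fun t ht => hg' t ht.1 (ht.2 y (R y))⟩
  · have := hg.1.2
    omega

theorem rank_of_covBy {σ τ : NC m} (h : σ ⋖ τ) : τ.rank = σ.rank + 1 := by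
  obtain ⟨y, -, hy, hτ, -⟩ := exists_label h
  rw [rank, hτ, Set.ncard_insert_of_notMem hy, rank]

theorem reflTransGen_covBy {σ τ : NC m} (h : σ ≤ τ) : ReflTransGen (· ⋖ ·) σ τ := by
  classical
  have := Fintype.ofFinite (NC m)
  have : LocallyFiniteOrder (NC m) := Fintype.toLocallyFiniteOrder
  exact le_iff_reflTransGen_covBy.1 h

end NC

/-! ### Edges whose label is not `n` -/

theorem isParkingFunction_of_le_injective {n : ℕ} {a : Fin n → ℕ} (h1 : ∀ i, 1 ≤ a i)
    {e : Fin n → Fin n} (he : Function.Injective e) (h : ∀ i, a i ≤ (e i : ℕ) + 1) :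
    IsParkingFunction a := by
  have hmono : Monotone (a ∘ Tuple.sort a) := Tuple.monotone_sort a
  refine ⟨h1, Tuple.sort a, hmono, fun i => ?_⟩
  by_contra! hi
  -- otherwise `e` maps the `n - i` positions from `i` on injectively into the values above `i`
  have hcard : (Finset.Ici i).card ≤ (Finset.Ioi i).card := by
    refine Finset.card_le_card_of_injOn (fun j => e (Tuple.sort a j)) (fun j hj => ?_)
      ((he.comp (Equiv.injective _)).injOn)
    have h2 : a (Tuple.sort a i) ≤ a (Tuple.sort a j) := hmono (Finset.mem_Ici.1 hj)
    have h3 := h (Tuple.sort a j)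
    simp only [Finset.coe_Ioi, Set.mem_Ioi, Fin.lt_def]
    omega
  rw [Fin.card_Ici, Fin.card_Ioi] at hcard
  omega

/-- The element `n` of `{1, …, n + 1}`. -/
def penult (n : ℕ) : Fin (n + 1) := ⟨n - 1, by omega⟩

/-- The block of `n + 1` is a singleton. -/
def LastAlone {n : ℕ} (σ : NC (n + 1)) : Prop := ∀ j, σ.1 j (Fin.last n) → j = Fin.last n

/-- The elements `n` and `n + 1` lie in the same block. -/
def LastJoined {n : ℕ} (σ : NC (n + 1)) : Prop := σ.1 (penult n) (Fin.last n)

/-- The covering relations whose label is not `n`, described without labels: the label is `n` if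
and only if the relation joins `n + 1`, from a singleton block, to the block of `n`. -/
def AllowedEdge {n : ℕ} (σ τ : NC (n + 1)) : Prop := σ ⋖ τ ∧ ¬ (LastAlone σ ∧ LastJoined τ)

variable {n : ℕ}

theorem LastAlone.anti {σ τ : NC (n + 1)} (h : σ ≤ τ) (hτ : LastAlone τ) : LastAlone σ :=
  fun j hj => hτ j (h hj)

theorem LastJoined.mono {σ τ : NC (n + 1)} (h : σ ≤ τ) (hσ : LastJoined σ) : LastJoined τ :=
  h hσ

theorem penult_lt_last (hn : 1 ≤ n) : penult n < Fin.last n := by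
  simp only [penult, Fin.lt_def, Fin.val_last]
  omega

theorem lt_penult_or (x : Fin (n + 1)) : x < penult n ∨ x = penult n ∨ x = Fin.last n := by
  simp only [penult, Fin.lt_def, Fin.ext_iff, Fin.val_last]
  omega

theorem LastAlone.not_lastJoined (hn : 1 ≤ n) {σ : NC (n + 1)} (h : LastAlone σ) :
    ¬ LastJoined σ := fun h' => (penult_lt_last hn).ne (h _ h')

/-- The label of a covering relation is `n` only if the relation joins `n + 1`, from a singleton
block, to the block of `n`. -/
theorem AllowedEdge.label_ne (hn : 1 ≤ n) {σ τ : NC (n + 1)} (h : AllowedEdge σ τ) {l : ℕ}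
    (hl : IsEdgeLabel σ τ l) : l ≠ n := by
  rintro rfl
  obtain ⟨B₁, B₂, ⟨p, rfl⟩, ⟨q, rfl⟩, hne, ⟨r, hr⟩, -, x, ⟨⟨hx₁, hx₂⟩, -⟩, hx⟩ := hl
  have hxp : x = penult l := by
    simp only [penult, Fin.ext_iff]
    omega
  have hB : ∀ z, σ.1 z q → z = Fin.last l := fun z hz => by
    have := hx₂ z hz
    simp only [Fin.lt_def, Fin.ext_iff, Fin.val_last] at this ⊢
    omega
  have hq := hB q (σ.1.refl q)
  subst hq hxp
  refine h.2 ⟨hB, ?_⟩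
  have h1 : penult l ∈ {x | τ.1 x r} := hr ▸ Or.inl hx₁
  have h2 : Fin.last l ∈ {x | τ.1 x r} := hr ▸ Or.inr (σ.1.refl _)
  exact τ.1.trans h1 (τ.1.symm h2)

/-- A covering relation that joins `n + 1`, from a singleton block, to the block of `n` has the
label `n` and no other. -/
theorem allowedEdge_of_label_ne (hn : 1 ≤ n) {σ τ : NC (n + 1)} (h : σ ⋖ τ) {l : ℕ}
    (hl : IsEdgeLabel σ τ l) (hne : l ≠ n) : AllowedEdge σ τ := by
  refine ⟨h, fun ⟨hA, hC⟩ => hne ?_⟩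
  obtain ⟨B₁, B₂, ⟨p, rfl⟩, ⟨q, rfl⟩, hB, ⟨r, hr⟩, ⟨b, hb, hbm⟩, x, ⟨⟨hx₁, hx₂⟩, hx₃⟩, rfl⟩ := hl
  obtain ⟨x', y', hxy, hn', -, -, hτ⟩ := NC.exists_of_covBy h
  have S : ∀ {a b}, σ.1 a b → σ.1 b a := σ.1.symm
  have T : ∀ {a b c}, σ.1 a b → σ.1 b c → σ.1 a c := σ.1.trans
  have hpl := penult_lt_last hn
  have hpn : ¬ σ.1 (penult n) (Fin.last n) := hA.not_lastJoined hn
  have hpq : ¬ σ.1 p q := by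
    intro hpq
    apply hB
    ext z
    exact ⟨fun h => T h hpq, fun h => T h (S hpq)⟩
  have hτpq : τ.1 p q := by
    have h1 : p ∈ {x | τ.1 x r} := hr ▸ Or.inl (σ.1.refl p)
    have h2 : q ∈ {x | τ.1 x r} := hr ▸ Or.inr (σ.1.refl q)
    exact τ.1.trans h1 (τ.1.symm h2)
  -- only two blocks of `σ` are united, so that these are the blocks of `n` and `n + 1`
  have hcases : (σ.1 (penult n) p ∧ σ.1 (Fin.last n) q) ∨
      (σ.1 (penult n) q ∧ σ.1 (Fin.last n) p) := by
    rcases (hτ _ _).1 hC with h1 | h1 | h1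
    · exact absurd h1 hpn
    · rcases (hτ _ _).1 hτpq with h2 | h2 | h2
      · exact absurd h2 hpq
      · exact Or.inl ⟨T h1.1 (S h2.1), T h1.2 (S h2.2)⟩
      · exact Or.inr ⟨T h1.1 (S h2.2), T h1.2 (S h2.1)⟩
    · rcases (hτ _ _).1 hτpq with h2 | h2 | h2
      · exact absurd h2 hpq
      · exact Or.inr ⟨T h1.1 (S h2.2), T h1.2 (S h2.1)⟩
      · exact Or.inl ⟨T h1.1 (S h2.1), T h1.2 (S h2.2)⟩
  rcases hcases with ⟨h1, h2⟩ | ⟨h1, h2⟩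
  · have hz : ∀ z, σ.1 z q → z = Fin.last n := fun z hz => hA z (T hz (S h2))
    have hge : penult n ≤ x := hx₃ ⟨h1, fun z hz' => by
      rw [hz z hz']
      exact hpl⟩
    have hlt : x < Fin.last n := hx₂ _ h2
    simp only [penult, Fin.le_def, Fin.lt_def, Fin.val_last] at hge hlt
    omega
  · have hb' : b = Fin.last n := hA b (T hb (S h2))
    have hle : b ≤ penult n := hbm.2 (Or.inr h1)
    rw [hb'] at hle
    exact absurd hpl (not_lt.2 hle)

/-- A sequence that visits `σ` at the index `rk σ` after steps of `R` can be continued along an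
`R`-path from `σ` to `τ`, where each step raises `rk` by one, so as to visit `τ` at the index
`rk τ`. -/
theorem exists_chain_extend {α : Type*} {R : α → α → Prop} {rk : α → ℕ}
    (hR : ∀ a b, R a b → rk b = rk a + 1) {σ τ : α} (h : ReflTransGen R σ τ) {c : ℕ → α}
    (hc : c (rk σ) = σ) (hs : ∀ i < rk σ, R (c i) (c (i + 1))) :
    rk σ ≤ rk τ ∧ ∃ c' : ℕ → α, (∀ i ≤ rk σ, c' i = c i) ∧ c' (rk τ) = τ ∧
      ∀ i < rk τ, R (c' i) (c' (i + 1)) := by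
  induction h with
  | refl => exact ⟨le_rfl, c, fun _ _ => rfl, hc, hs⟩
  | @tail u v _ huv ih =>
    obtain ⟨hle, c', h1, h2, h3⟩ := ih
    have hv := hR u v huv
    refine ⟨by omega, Function.update c' (rk v) v, fun i hi => ?_, by simp, fun i hi => ?_⟩
    · rw [Function.update_of_ne (by omega), h1 i hi]
    · rw [Function.update_of_ne (by omega)]
      by_cases hiu : i = rk u
      · subst hiu
        rw [← hv, Function.update_self, h2]
        exact huv
      · rw [Function.update_of_ne (by omega)]
        exact h3 i (by omega)

/-- A path of allowed edges from the bottom to the top is one of the chains of `PF_{n,n}`: if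
`y i` is the block minimum that the `i`-th step makes non-minimal, then `i ↦ y i` is injective
and the labels are at most `y i`. -/
theorem isPFChain_of_allowedEdge (hn : 1 ≤ n) {c : ℕ → NC (n + 1)} (h0 : c 0 = ⊥) (hl : c n = ⊤)
    (hs : ∀ i < n, AllowedEdge (c i) (c (i + 1))) :
    IsPFChain n n (fun i : Fin (n + 1) => c i) := by
  refine ⟨⟨NC.eq_bot_iff_val.2 h0, NC.eq_top_iff_val.2 hl, fun i => (hs i i.2).1⟩, ?_⟩
  choose y a hy hins hlab h1 hle using fun i : Fin n => NC.exists_label (hs i i.2).1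
  have hmono : ∀ i j : ℕ, i ≤ j → j ≤ n → (c i).nonMin ⊆ (c j).nonMin := by
    intro i j hij
    induction j, hij using Nat.le_induction with
    | base => exact fun _ => subset_rfl
    | succ j hij ih => exact fun hj =>
        (ih (by omega)).trans (NC.nonMin_mono (hs j (by omega)).1.le)
  have hlt : ∀ i j : Fin n, i < j → y i ≠ y j := by
    intro i j hij heq
    refine hy j (hmono (i + 1) j hij j.2.le ?_)
    rw [hins i, ← heq]
    exact Set.mem_insert _ _
  have hypos : ∀ i, 1 ≤ (y i : ℕ) := fun i => (h1 i).trans (hle i)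
  refine ⟨a, ⟨isParkingFunction_of_le_injective h1
    (e := fun i => ⟨(y i : ℕ) - 1, by have := hypos i; omega⟩) ?_ ?_,
    fun i => (hs i i.2).label_ne hn (hlab i), fun m h h' => by omega⟩, hlab⟩
  · intro i j hij
    have hij' : y i = y j := by
      have := hypos i
      have := hypos j
      simp only [Fin.mk.injEq] at hij
      omega
    rcases lt_trichotomy i j with h | h | h
    · exact absurd hij' (hlt i j h)
    · exact h
    · exact absurd hij'.symm (hlt j i h)
  · intro i
    have := hypos i
    have := hle i
    simp only
    omega

theorem IsPFChain.allowedEdge (hn : 1 ≤ n) {c : Fin (n + 1) → NC (n + 1)} (hc : IsPFChain n n c)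
    (i : Fin n) : AllowedEdge (c i.castSucc) (c i.succ) := by
  obtain ⟨hmax, a, ha, hl⟩ := hc
  exact allowedEdge_of_label_ne hn (hmax.2.2 i) (hl i) (ha.2.1 i)

theorem IsPFChain.reflTransGen_bot (hn : 1 ≤ n) {c : Fin (n + 1) → NC (n + 1)}
    (hc : IsPFChain n n c) (i : Fin (n + 1)) : ReflTransGen AllowedEdge ⊥ (c i) := by
  induction i using Fin.induction with
  | zero => rw [NC.eq_bot_iff_val.1 hc.1.1]
  | succ i ih => exact ih.tail (hc.allowedEdge hn i)

theorem IsPFChain.reflTransGen_top (hn : 1 ≤ n) {c : Fin (n + 1) → NC (n + 1)}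
    (hc : IsPFChain n n c) (i : Fin (n + 1)) : ReflTransGen AllowedEdge (c i) ⊤ := by
  induction i using Fin.reverseInduction with
  | last => rw [NC.eq_top_iff_val.1 hc.1.2.1]
  | cast i ih => exact ih.head (hc.allowedEdge hn i)

theorem AllowedEdge.rank {σ τ : NC (n + 1)} (h : AllowedEdge σ τ) : τ.rank = σ.rank + 1 :=
  NC.rank_of_covBy h.1

theorem hasseEdge_iff (hn : 1 ≤ n) {σ τ : NC (n + 1)} : HasseEdge n n σ τ ↔
    ReflTransGen AllowedEdge ⊥ σ ∧ AllowedEdge σ τ ∧ ReflTransGen AllowedEdge τ ⊤ := by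
  constructor
  · rintro ⟨c, hc, i, rfl, rfl⟩
    exact ⟨hc.reflTransGen_bot hn _, hc.allowedEdge hn i, hc.reflTransGen_top hn _⟩
  · rintro ⟨h1, h2, h3⟩
    have hR : ∀ a b : NC (n + 1), AllowedEdge a b → b.rank = a.rank + 1 := fun _ _ h => h.rank
    obtain ⟨-, c1, e1, e2, e3⟩ := exists_chain_extend hR h1 (c := fun _ => ⊥) rfl
      (fun i hi => by simp [NC.rank_bot] at hi)
    obtain ⟨hle2, c2, f1, f2, f3⟩ := exists_chain_extend hR (ReflTransGen.single h2) e2 e3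
    obtain ⟨hle3, c3, g1, g2, g3⟩ := exists_chain_extend hR h3 f2 f3
    have hrk := h2.rank
    simp only [NC.rank_bot, NC.rank_top] at e1 g2 g3 hle3
    refine ⟨_, isPFChain_of_allowedEdge hn (c := c3) ?_ g2 g3, ⟨σ.rank, by omega⟩, ?_, ?_⟩
    · rw [g1 0 (by omega), f1 0 (by omega), e1 0 le_rfl]
    · simp only [Fin.val_castSucc]
      rw [g1 _ hle2, f1 _ le_rfl, e2]
    · simp only [Fin.val_succ]
      rw [← hrk, g1 _ le_rfl, f2]

theorem mem_posetPF_iff (hn : 1 ≤ n) {σ : NC (n + 1)} :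
    (∃ c, IsPFChain n n c ∧ ∃ i, c i = σ) ↔
      ReflTransGen AllowedEdge ⊥ σ ∧ ReflTransGen AllowedEdge σ ⊤ := by
  constructor
  · rintro ⟨c, hc, i, rfl⟩
    exact ⟨hc.reflTransGen_bot hn i, hc.reflTransGen_top hn i⟩
  · rintro ⟨h1, h2⟩
    rcases h1.cases_tail with h | ⟨ρ, h3, h4⟩
    · subst h
      rcases h2.cases_head with h | ⟨ρ, h3, h4⟩
      · have := congrArg NC.rank h
        rw [NC.rank_bot, NC.rank_top] at this
        omega
      · obtain ⟨c, hc, i, hi, -⟩ := (hasseEdge_iff hn).2 ⟨h1, h3, h4⟩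
        exact ⟨c, hc, _, hi⟩
    · obtain ⟨c, hc, i, -, hi⟩ := (hasseEdge_iff hn).2 ⟨h3, h4, h2⟩
      exact ⟨c, hc, _, hi⟩

theorem posetPF_le_iff (hn : 1 ≤ n) {σ τ : PosetPF n n} :
    σ ≤ τ ↔ ReflTransGen AllowedEdge σ.1 τ.1 := by
  change ReflTransGen (HasseEdge n n) σ.1 τ.1 ↔ _
  refine ⟨fun h => ReflTransGen.mono (fun _ _ h => ((hasseEdge_iff hn).1 h).2.1) _ _ h, fun h => ?_⟩
  have hσ := ((mem_posetPF_iff hn).1 σ.2).1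
  have hτ := ((mem_posetPF_iff hn).1 τ.2).2
  generalize τ.1 = ρ at h hτ
  induction h with
  | refl => exact ReflTransGen.refl
  | tail h e ih => exact (ih (hτ.head e)).tail ((hasseEdge_iff hn).2 ⟨hσ.trans h, e, hτ⟩)

/-! ### The elements and the order of `Poset(PF_{n,n})` -/

theorem NC.le_of_lt {m : ℕ} {σ τ : NC m} (h : ∀ u v, u < v → σ.1 u v → τ.1 u v) : σ ≤ τ :=
  NC.le_iff.2 fun u v huv => by
    rcases lt_trichotomy u v with hlt | rfl | hlt
    · exact h u v hlt huv
    · exact τ.1.refl u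
    · exact τ.1.symm (h v u hlt (σ.1.symm huv))

theorem exists_rel_last {σ : NC (n + 1)} (h : ¬ LastAlone σ) :
    ∃ j, σ.1 j (Fin.last n) ∧ j ≠ Fin.last n := by
  simpa only [LastAlone, not_forall, exists_prop] using h

theorem not_lastAlone {σ : NC (n + 1)} {j : Fin (n + 1)} (hj : j < penult n)
    (h : σ.1 j (Fin.last n)) : ¬ LastAlone σ := fun h' => by
  have := h' j h
  simp only [Fin.lt_def, penult, Fin.ext_iff, Fin.val_last] at hj this
  omega

theorem reflTransGen_of_le {σ τ : NC (n + 1)} (h : σ ≤ τ)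
    (h' : ¬ LastAlone σ ∨ ¬ LastJoined τ) : ReflTransGen AllowedEdge σ τ := by
  have : ∀ ρ, ReflTransGen (· ⋖ ·) σ ρ → σ ≤ ρ ∧
      ((¬ LastAlone σ ∨ ¬ LastJoined ρ) → ReflTransGen AllowedEdge σ ρ) := by
    intro ρ hρ
    induction hρ with
    | refl => exact ⟨le_rfl, fun _ => ReflTransGen.refl⟩
    | tail _ e ih =>
      refine ⟨ih.1.trans e.le, fun h => (ih.2 ?_).tail ⟨e, ?_⟩⟩
      · exact h.imp_right fun h hC => h (hC.mono e.le)
      · rintro ⟨hA, hC⟩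
        exact h.elim (fun h => h (hA.anti ih.1)) fun h => h hC
  exact (this τ (NC.reflTransGen_covBy h)).2 h'

theorem le_of_reflTransGen_allowed {σ τ : NC (n + 1)} (h : ReflTransGen AllowedEdge σ τ) :
    σ ≤ τ := by
  induction h with
  | refl => exact le_rfl
  | tail _ e ih => exact ih.trans e.1.le

/-- A path of allowed edges cannot join `n + 1` to `n` in the step in which `n + 1` ceases to be
a singleton block. -/
theorem exists_between (hn : 1 ≤ n) {σ τ : NC (n + 1)}
    (h : ReflTransGen AllowedEdge σ τ) (hA : LastAlone σ) (hC : LastJoined τ) :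
    ∃ β, ¬ LastAlone β ∧ ¬ LastJoined β ∧ σ ≤ β ∧ β ≤ τ := by
  induction h using ReflTransGen.head_induction_on with
  | refl => exact absurd hC (hA.not_lastJoined hn)
  | @head u v e p ih =>
    have hvC : ¬ LastJoined v := fun h => e.2 ⟨hA, h⟩
    by_cases hv : LastAlone v
    · obtain ⟨β, h1, h2, h3, h4⟩ := ih hv
      exact ⟨β, h1, h2, e.1.le.trans h3, h4⟩
    · exact ⟨v, hv, hvC, e.1.le, le_of_reflTransGen_allowed p⟩

/-- The partition into the interval from `m` to `n` and its complement. -/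
def splitAt (m : Fin (n + 1)) : NC (n + 1) :=
  ⟨{ r := fun x y => (m ≤ x ∧ x ≠ Fin.last n) ↔ (m ≤ y ∧ y ≠ Fin.last n)
     iseqv := ⟨fun _ => Iff.rfl, fun h => h.symm, fun h h' => h.trans h'⟩ }, by
    intro a b c d hab hbc hcd hac hbd
    change (m ≤ a ∧ a ≠ Fin.last n) ↔ (m ≤ c ∧ c ≠ Fin.last n) at hac
    change (m ≤ b ∧ b ≠ Fin.last n) ↔ (m ≤ d ∧ d ≠ Fin.last n) at hbd
    change (m ≤ a ∧ a ≠ Fin.last n) ↔ (m ≤ b ∧ b ≠ Fin.last n)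
    simp only [Fin.lt_def, Fin.le_def, ne_eq, Fin.ext_iff, Fin.val_last] at *
    omega⟩

theorem splitAt_rel {m x y : Fin (n + 1)} : (splitAt m).1 x y ↔
    ((m ≤ x ∧ x ≠ Fin.last n) ↔ (m ≤ y ∧ y ≠ Fin.last n)) := Iff.rfl

theorem splitAt_rel_last {m x : Fin (n + 1)} (hx : x < penult n) :
    (splitAt m).1 x (Fin.last n) ↔ x < m := by
  rw [splitAt_rel]
  simp only [penult, Fin.lt_def, Fin.le_def, ne_eq, Fin.ext_iff, not_true_eq_false, and_false,
    iff_false, Fin.val_last] at *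
  omega

theorem splitAt_rel_penult (hn : 1 ≤ n) {m : Fin (n + 1)} (hm : m ≤ penult n) :
    (splitAt m).1 m (penult n) := by
  rw [splitAt_rel]
  simp only [penult, Fin.le_def, ne_eq, Fin.ext_iff, Fin.val_last] at *
  omega

theorem not_lastAlone_splitAt (hn : 1 ≤ n) {m : Fin (n + 1)} (hm : 0 < m) :
    ¬ LastAlone (splitAt m) := by
  intro h
  have h0 : (0 : Fin (n + 1)) = Fin.last n := h 0 (by
    rw [splitAt_rel]
    simp only [Fin.le_def, Fin.lt_def, ne_eq, Fin.ext_iff, not_true_eq_false, and_false,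
      iff_false, Fin.val_last, Fin.val_zero] at *
    omega)
  simp only [Fin.ext_iff, Fin.val_last, Fin.val_zero] at h0
  omega

theorem not_lastJoined_splitAt (hn : 1 ≤ n) {m : Fin (n + 1)} (hm : m ≤ penult n) :
    ¬ LastJoined (splitAt m) := by
  intro h
  have h := splitAt_rel.1 h
  simp only [penult, Fin.le_def, ne_eq, Fin.ext_iff, not_true_eq_false, and_false,
    iff_false, Fin.val_last] at *
  omega

/-- A partition in which neither `1` nor `n + 1` is joined to `n` lies below the partition
`splitAt m`, where `m > 1` is the minimum of the block of `n`. -/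
theorem exists_le_splitAt (hn : 1 ≤ n) {σ : NC (n + 1)} (h0 : ¬ σ.1 0 (penult n))
    (hC : ¬ LastJoined σ) :
    ∃ m, 0 < m ∧ m ≤ penult n ∧ σ.1 m (penult n) ∧ σ ≤ splitAt m := by
  obtain ⟨m, hm, hmin⟩ := σ.exists_min_class (penult n)
  have S : ∀ {a b}, σ.1 a b → σ.1 b a := σ.1.symm
  have T : ∀ {a b c}, σ.1 a b → σ.1 b c → σ.1 a c := σ.1.trans
  have hmp : m ≤ penult n := hmin _ (σ.1.refl _)
  have hpl := penult_lt_last hn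
  have hm0 : 0 < m := by
    rw [Fin.pos_iff_ne_zero]
    rintro rfl
    exact h0 (S hm)
  refine ⟨m, hm0, hmp, S hm, NC.le_of_lt fun u v huv h => ?_⟩
  rw [splitAt_rel]
  by_contra hcon
  -- the chord from `u` to `v` would cross the chord from `m` to `n`
  have hcases : (u < m ∧ m ≤ v ∧ v ≤ penult n) ∨ (m ≤ u ∧ u ≤ penult n ∧ v = Fin.last n) := by
    have := lt_penult_or u
    have := lt_penult_or v
    simp only [penult, Fin.lt_def, Fin.le_def, ne_eq, Fin.ext_iff, Fin.val_last] at *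
    omega
  rcases hcases with ⟨h1, h2, h3⟩ | ⟨h1, h2, rfl⟩
  · have hu : ¬ σ.1 u (penult n) := fun h => absurd (hmin u (S h)) (not_le.2 h1)
    rcases h2.eq_or_lt with rfl | h2
    · exact hu (T h (S hm))
    · rcases h3.eq_or_lt with rfl | h3
      · exact hu h
      · exact hu (T (σ.2 u m v _ h1 h2 h3 h (S hm)) (S hm))
  · rcases h1.eq_or_lt with rfl | h1
    · exact hC (T hm h)
    · rcases h2.eq_or_lt with rfl | h2
      · exact hC h
      · exact hC (T hm (T (σ.2 m u _ _ h1 h2 hpl (S hm) h) h))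

/-- The elements of `Poset(PF_{n,n})`: `1` may be joined to `n` only together with `n + 1`, and
`{n, n + 1}` is not a block. -/
theorem mem_posetPF_iff_rel (hn : 2 ≤ n) {σ : NC (n + 1)} :
    (∃ c, IsPFChain n n c ∧ ∃ i, c i = σ) ↔ (σ.1 0 (penult n) → LastJoined σ) ∧
      (LastJoined σ → ∃ j < penult n, σ.1 j (Fin.last n)) := by
  have hn1 : 1 ≤ n := by omega
  have hpl := penult_lt_last hn1
  have h0p : (0 : Fin (n + 1)) < penult n := by
    simp only [penult, Fin.lt_def, Fin.val_zero]
    omega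
  rw [mem_posetPF_iff hn1]
  constructor
  · rintro ⟨hbot, htop⟩
    constructor
    · induction htop using ReflTransGen.head_induction_on with
      | refl => exact fun _ => NC.top_rel _ _
      | @head u v e p ih =>
        intro h
        have hv := ih (hbot.tail e) (e.1.le h)
        obtain ⟨j, hj, hjl⟩ := exists_rel_last fun hA => e.2 ⟨hA, hv⟩
        have S : ∀ {a b}, u.1 a b → u.1 b a := u.1.symm
        have T : ∀ {a b c}, u.1 a b → u.1 b c → u.1 a c := u.1.trans
        rcases lt_penult_or j with h1 | rfl | h1
        · rcases (Fin.zero_le j).eq_or_lt with rfl | h2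
          · exact T (S h) hj
          · exact T (S h) (T (u.2 0 j _ _ h2 h1 hpl h hj) hj)
        · exact hj
        · exact absurd h1 hjl
    · clear htop
      induction hbot with
      | refl => exact fun h => absurd (NC.bot_rel.1 h) hpl.ne
      | @tail u v p e ih =>
        intro hv
        obtain ⟨j, hj, hjl⟩ := exists_rel_last fun hA => e.2 ⟨hA, hv⟩
        rcases lt_penult_or j with h1 | rfl | h1
        · exact ⟨j, h1, e.1.le hj⟩
        · obtain ⟨k, hk, hk'⟩ := ih hj
          exact ⟨k, hk, e.1.le hk'⟩
        · exact absurd h1 hjl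
  · rintro ⟨h1, h2⟩
    have hbot : ¬ LastJoined (⊥ : NC (n + 1)) := fun h => hpl.ne (NC.bot_rel.1 h)
    by_cases hC : LastJoined σ
    · obtain ⟨j, hj, hjl⟩ := h2 hC
      have hβA : ¬ LastAlone (NC.block {Fin.last n, j}) :=
        not_lastAlone hj (NC.block_rel.2 (by simp))
      have hβC : ¬ LastJoined (NC.block {Fin.last n, j}) := fun h => by
        have := NC.block_rel.1 h
        simp [hpl.ne, hj.ne'] at this
      exact ⟨(reflTransGen_of_le bot_le (Or.inr hβC)).trans (reflTransGen_of_le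
        (NC.block_pair_le.2 (σ.1.symm hjl)) (Or.inl hβA)),
        reflTransGen_of_le le_top (Or.inl (not_lastAlone hj hjl))⟩
    · obtain ⟨m, hm, hm', -, hle⟩ := exists_le_splitAt hn1 (fun h => hC (h1 h)) hC
      exact ⟨reflTransGen_of_le bot_le (Or.inr hC),
        (reflTransGen_of_le hle (Or.inr (not_lastJoined_splitAt hn1 hm'))).trans
          (reflTransGen_of_le le_top (Or.inl (not_lastAlone_splitAt hn1 hm)))⟩

namespace PosetPF

theorem le_val {x y : PosetPF n n} (h : x ≤ y) : x.1 ≤ y.1 := le_of_reflTransGen h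

theorem le_of_not_lastAlone (hn : 2 ≤ n) {x y : PosetPF n n} (hx : ¬ LastAlone x.1)
    (h : x.1 ≤ y.1) : x ≤ y :=
  (posetPF_le_iff (by omega)).2 (reflTransGen_of_le h (Or.inl hx))

theorem le_of_not_lastJoined (hn : 2 ≤ n) {x y : PosetPF n n} (hy : ¬ LastJoined y.1)
    (h : x.1 ≤ y.1) : x ≤ y :=
  (posetPF_le_iff (by omega)).2 (reflTransGen_of_le h (Or.inr hy))

theorem lastJoined_of_rel (hn : 2 ≤ n) (x : PosetPF n n) (h : x.1.1 0 (penult n)) :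
    LastJoined x.1 := ((mem_posetPF_iff_rel hn).1 x.2).1 h

theorem exists_of_lastJoined (hn : 2 ≤ n) (x : PosetPF n n) (h : LastJoined x.1) :
    ∃ j < penult n, x.1.1 j (Fin.last n) := ((mem_posetPF_iff_rel hn).1 x.2).2 h

end PosetPF

/-! ### Order-theoretic descriptions -/

section Order

variable {α : Type*} [PartialOrder α]

/-- The only elements below `x` are minimal elements and the non-minimal element `b`. -/
def IsStem (b x : α) : Prop := ¬ IsMin b ∧ b < x ∧ ∀ z < x, IsMin z ∨ z = b

/-- Some element `a` has, together with `b`, an upper bound that is not above `x`, whereas all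
common upper bounds of `a` and `b'` are above `x'`. -/
def StemLT (b x b' x' : α) : Prop :=
  ∃ a, (∃ y, b ≤ y ∧ a ≤ y ∧ ¬ x ≤ y) ∧ ∀ y, b' ≤ y → a ≤ y → x' ≤ y

theorem IsStem.map (f : α ≃o α) {b x : α} (h : IsStem b x) : IsStem (f b) (f x) := by
  refine ⟨fun hm => h.1 (f.isMin_apply.1 hm), f.lt_iff_lt.2 h.2.1, fun z hz => ?_⟩
  rcases h.2.2 (f.symm z) (f.symm_apply_lt.2 hz) with h1 | h1
  · exact Or.inl (f.symm.isMin_apply.1 h1)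
  · exact Or.inr (f.symm_apply_eq.1 h1)

theorem StemLT.map (f : α ≃o α) {b x b' x' : α} (h : StemLT b x b' x') :
    StemLT (f b) (f x) (f b') (f x') := by
  obtain ⟨a, ⟨y, h1, h2, h3⟩, h4⟩ := h
  refine ⟨f a, ⟨f y, f.le_iff_le.2 h1, f.le_iff_le.2 h2, fun h => h3 (f.le_iff_le.1 h)⟩, ?_⟩
  intro y hb ha
  exact f.le_symm_apply.1 (h4 _ (f.le_symm_apply.2 hb) (f.le_symm_apply.2 ha))

end Order

theorem zero_lt_penult (hn : 2 ≤ n) : (0 : Fin (n + 1)) < penult n := by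
  simp only [penult, Fin.lt_def, Fin.val_zero]
  omega

theorem NC.not_lastJoined_block {S : Set (Fin (n + 1))} (hn : 2 ≤ n)
    (h : penult n ∉ S ∨ Fin.last n ∉ S) : ¬ LastJoined (NC.block S) := by
  intro hC
  rcases NC.block_rel.1 hC with h1 | h1
  · exact (penult_lt_last (by omega)).ne h1
  · exact h.elim (fun h => h h1.1) fun h => h h1.2

/-- If `n + 1` is a singleton of `σ`, it may be dropped from a block above `σ`. -/
theorem LastAlone.le_block {S : Set (Fin (n + 1))} {σ : NC (n + 1)} (hA : LastAlone σ)
    (h : σ ≤ NC.block (insert (Fin.last n) S)) : σ ≤ NC.block S :=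
  NC.le_of_lt fun u v huv huv' => by
    have hv : v ≠ Fin.last n := by
      rintro rfl
      exact huv.ne (hA u huv')
    have hu : u ≠ Fin.last n := fun h => (Fin.le_last v).not_gt (h ▸ huv)
    rcases NC.block_rel.1 (h huv') with h1 | ⟨h1, h2⟩
    · exact absurd h1 huv.ne
    · exact NC.block_rel.2 (Or.inr ⟨h1.resolve_left hu, h2.resolve_left hv⟩)

theorem NC.block_singleton {m : ℕ} (i : Fin m) : NC.block {i} = ⊥ :=
  le_bot_iff.1 (NC.block_le.2 fun x hx y hy => NC.bot_rel.2 (by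
    rw [Set.mem_singleton_iff.1 hx, Set.mem_singleton_iff.1 hy]))

namespace PosetPF

theorem mem_of_not_lastJoined (hn : 2 ≤ n) {σ : NC (n + 1)} (h0 : ¬ σ.1 0 (penult n))
    (hC : ¬ LastJoined σ) : ∃ c, IsPFChain n n c ∧ ∃ i, c i = σ :=
  (mem_posetPF_iff_rel hn).2 ⟨fun h => absurd h h0, fun h => absurd h hC⟩

/-- The partition with the only nontrivial block `{i, n + 1}`, for `i < n`. -/
def stemBot (hn : 2 ≤ n) (i : Fin (n + 1)) (hi : i < penult n) : PosetPF n n :=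
  ⟨NC.block {Fin.last n, i}, mem_of_not_lastJoined hn (fun h => by
    have hpl := penult_lt_last (n := n) (by omega)
    have h0p := zero_lt_penult hn
    rcases NC.block_rel.1 h with h | h
    · exact h0p.ne h
    · rcases h.2 with h | h
      · exact hpl.ne h
      · exact hi.ne' h) (NC.not_lastJoined_block hn (Or.inl (by
    have hpl := penult_lt_last (n := n) (by omega)
    simp [hpl.ne, hi.ne'])))⟩

/-- The partition with the only nontrivial block `{i, n, n + 1}`, for `i < n`. -/
def stemTop (hn : 2 ≤ n) (i : Fin (n + 1)) (hi : i < penult n) : PosetPF n n :=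
  ⟨NC.block {Fin.last n, penult n, i}, (mem_posetPF_iff_rel hn).2
    ⟨fun _ => NC.block_rel.2 (Or.inr ⟨by simp, by simp⟩),
      fun _ => ⟨i, hi, NC.block_rel.2 (Or.inr ⟨by simp, by simp⟩)⟩⟩⟩

/-- The partition with the only nontrivial block `{i, j}`, where `i < j ≤ n`. -/
def pair (hn : 2 ≤ n) (i j : Fin (n + 1)) (hij : i < j) (hj : j ≤ penult n)
    (h0 : ¬ (i = 0 ∧ j = penult n)) : PosetPF n n :=
  ⟨NC.block {i, j}, mem_of_not_lastJoined hn (fun h => by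
    have h0p := zero_lt_penult hn
    rcases NC.block_rel.1 h with h | ⟨h1, h2⟩
    · exact h0p.ne h
    · have hi : penult n ≠ i := (hij.trans_le hj).ne'
      have hj' : penult n = j := by simpa [hi] using h2
      subst hj'
      have : (0 : Fin (n + 1)) = i := by simpa [h0p.ne] using h1
      exact h0 ⟨this.symm, rfl⟩) (NC.not_lastJoined_block hn (Or.inr (by
    have hpl := penult_lt_last (n := n) (by omega)
    simp [((hij.trans_le hj).trans hpl).ne', (hj.trans_lt hpl).ne'])))⟩

/-- The partition `splitAt m` as an element of the poset. -/
def split (hn : 2 ≤ n) (m : Fin (n + 1)) (h0 : 0 < m) (hm : m ≤ penult n) : PosetPF n n :=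
  ⟨splitAt m, mem_of_not_lastJoined hn (fun h => by
    have hpl := penult_lt_last (n := n) (by omega)
    exact absurd ((splitAt_rel.1 h).2 ⟨hm, hpl.ne⟩).1 (not_le.2 h0))
      (not_lastJoined_splitAt (by omega) hm)⟩

theorem stemBot_le (hn : 2 ≤ n) {i : Fin (n + 1)} {hi : i < penult n} {x : PosetPF n n} :
    stemBot hn i hi ≤ x ↔ x.1.1 i (Fin.last n) := by
  refine ⟨fun h => x.1.1.symm (NC.block_pair_le.1 (le_val h)), fun h => ?_⟩
  exact le_of_not_lastAlone hn (not_lastAlone hi (NC.block_rel.2 (by simp)))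
    (NC.block_pair_le.2 (x.1.1.symm h))

theorem stemTop_le (hn : 2 ≤ n) {i : Fin (n + 1)} {hi : i < penult n} {x : PosetPF n n} :
    stemTop hn i hi ≤ x ↔ x.1.1 i (Fin.last n) ∧ LastJoined x.1 := by
  constructor
  · intro h
    have h := NC.block_le.1 (le_val h)
    exact ⟨h i (by simp) _ (by simp), h _ (by simp) _ (by simp)⟩
  · rintro ⟨h1, h2⟩
    refine le_of_not_lastAlone hn (not_lastAlone hi (NC.block_rel.2 (by simp))) ?_
    have key : ∀ z ∈ ({Fin.last n, penult n, i} : Set (Fin (n + 1))), x.1.1 z (Fin.last n) := by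
      rintro z (rfl | rfl | rfl)
      exacts [x.1.1.refl _, h2, h1]
    exact NC.block_le.2 fun u hu v hv => x.1.1.trans (key u hu) (x.1.1.symm (key v hv))

theorem pair_not_lastJoined (hn : 2 ≤ n) {i j : Fin (n + 1)} {hij : i < j} {hj : j ≤ penult n}
    {h0 : ¬ (i = 0 ∧ j = penult n)} : ¬ LastJoined (pair hn i j hij hj h0).1 := by
  have hpl := penult_lt_last (n := n) (by omega)
  exact NC.not_lastJoined_block hn (Or.inr (by
    simp [((hij.trans_le hj).trans hpl).ne', (hj.trans_lt hpl).ne']))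

/-- A pair `{i, j}` with `j < n` lies below all partitions in which `i` and `j` are joined: if
these join `n` to `n + 1`, one passes through the partition with `n` made a singleton. -/
theorem pair_le (hn : 2 ≤ n) {i j : Fin (n + 1)} {hij : i < j} {hj : j < penult n}
    {h0 : ¬ (i = 0 ∧ j = penult n)} {x : PosetPF n n} :
    pair hn i j hij hj.le h0 ≤ x ↔ x.1.1 i j := by
  refine ⟨fun h => NC.block_pair_le.1 (le_val h), fun h => ?_⟩
  have hpl := penult_lt_last (n := n) (by omega)
  by_cases hC : LastJoined x.1
  · obtain ⟨k, hk, hkl⟩ := exists_of_lastJoined hn x hC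
    have hA : ¬ LastAlone (x.1.restrict {penult n}ᶜ) :=
      not_lastAlone hk (NC.restrict_rel.2 (Or.inr ⟨hk.ne, hpl.ne', hkl⟩))
    have hC' : ¬ LastJoined (x.1.restrict {penult n}ᶜ) := by
      intro h
      rcases NC.restrict_rel.1 h with h | h
      · exact hpl.ne h
      · exact h.1 rfl
    have hle : NC.block {i, j} ≤ x.1.restrict {penult n}ᶜ := NC.block_pair_le.2
      (NC.restrict_rel.2 (Or.inr ⟨(hij.trans hj).ne, hj.ne, h⟩))
    exact (posetPF_le_iff (by omega)).2 ((reflTransGen_of_le hle (Or.inr hC')).trans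
      (reflTransGen_of_le (NC.restrict_le _ _) (Or.inl hA)))
  · exact le_of_not_lastJoined hn hC (NC.block_pair_le.2 h)

/-- Two elements joined in `x`, where `x` does not join `n` to `n + 1`, form an atom below `x`. -/
theorem exists_pair (hn : 2 ≤ n) {x : PosetPF n n} (hC : ¬ LastJoined x.1) {k l : Fin (n + 1)}
    (h : x.1.1 k l) : ∃ a : PosetPF n n, a.1 = NC.block {k, l} ∧ a ≤ x := by
  have h0p := zero_lt_penult hn
  have hle : NC.block {k, l} ≤ x.1 := NC.block_pair_le.2 h
  refine ⟨⟨NC.block {k, l}, mem_of_not_lastJoined hn (fun h0 => ?_) fun h => hC (h.mono hle)⟩,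
    rfl, le_of_not_lastJoined hn hC hle⟩
  exact hC (lastJoined_of_rel hn x (hle h0))

theorem isMin_iff (hn : 2 ≤ n) {x : PosetPF n n} : IsMin x ↔ x.1 = ⊥ := by
  have hpl := penult_lt_last (n := n) (by omega)
  have h0p := zero_lt_penult hn
  constructor
  · intro h
    let b : PosetPF n n := ⟨⊥, mem_of_not_lastJoined hn (fun h => h0p.ne (NC.bot_rel.1 h))
      fun h => hpl.ne (NC.bot_rel.1 h)⟩
    have hb : b ≤ x := (posetPF_le_iff (by omega)).2 ((mem_posetPF_iff (by omega)).1 x.2).1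
    exact le_bot_iff.1 (le_val (h hb))
  · intro h y hy
    have : y.1 = ⊥ := le_bot_iff.1 ((le_val hy).trans h.le)
    have : y = x := Subtype.ext (this.trans h.symm)
    exact this.ge

theorem isStem_stemBot_stemTop (hn : 2 ≤ n) (i : Fin (n + 1)) (hi : i < penult n) :
    IsStem (stemBot hn i hi) (stemTop hn i hi) := by
  have hpl := penult_lt_last (n := n) (by omega)
  have hbC : ¬ LastJoined (stemBot hn i hi).1 :=
    NC.not_lastJoined_block hn (Or.inl (by simp [hpl.ne, hi.ne']))
  have htC : LastJoined (stemTop hn i hi).1 := NC.block_rel.2 (by simp)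
  have key : ∀ β : NC (n + 1), β ≤ (stemTop hn i hi).1 → ¬ LastJoined β → ¬ LastAlone β →
      β = (stemBot hn i hi).1 := by
    intro β hβ hC hA
    have hil : β.1 i (Fin.last n) := by
      obtain ⟨k, hk, hkl⟩ := exists_rel_last hA
      rcases NC.block_rel.1 (hβ hk) with h | ⟨h | h | h, -⟩
      · exact absurd h hkl
      · exact absurd h hkl
      · subst h
        exact absurd hk hC
      · exact h ▸ hk
    refine le_antisymm (NC.le_of_lt fun u v huv h => ?_) (NC.block_pair_le.2 (β.1.symm hil))
    have hp : ∀ w, β.1 w (penult n) →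
        w ∉ ({Fin.last n, i} : Set (Fin (n + 1))) := by
      rintro w hw (rfl | rfl)
      · exact hC (β.1.symm hw)
      · exact hC (β.1.trans (β.1.symm hw) hil)
    rcases NC.block_rel.1 (hβ h) with h' | ⟨h1, h2⟩
    · exact absurd h' huv.ne
    · refine NC.block_rel.2 (Or.inr ⟨?_, ?_⟩)
      · rcases h1 with rfl | rfl | rfl
        · simp
        · rcases h2 with rfl | rfl | rfl
          · exact absurd h hC
          · exact absurd huv (lt_irrefl _)
          · exact absurd (Or.inr rfl) (hp _ (β.1.symm h))
        · simp
      · rcases h2 with rfl | rfl | rfl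
        · simp
        · rcases h1 with rfl | rfl | rfl
          · exact absurd (Or.inl rfl) (hp _ h)
          · exact absurd huv (lt_irrefl _)
          · exact absurd (Or.inr rfl) (hp _ h)
        · simp
  refine ⟨fun h => ?_, ?_, fun z hz => ?_⟩
  · have h := (isMin_iff hn).1 h
    have h1 : (stemBot hn i hi).1.1 i (Fin.last n) := NC.block_rel.2 (by simp)
    rw [h] at h1
    exact (hi.trans hpl).ne (NC.bot_rel.1 h1)
  · refine lt_of_le_of_ne ((stemBot_le hn).2 (NC.block_rel.2 (by simp))) fun h => hbC ?_
    rw [h]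
    exact htC
  · by_cases hA : LastAlone z.1
    · obtain ⟨β, h1, h2, h3, h4⟩ :=
        exists_between (by omega) ((posetPF_le_iff (by omega)).1 hz.le) hA htC
      rw [key β h4 h2 h1] at h3
      refine Or.inl ((isMin_iff hn).2 (le_bot_iff.1 ?_))
      rw [← NC.block_singleton i]
      exact hA.le_block h3
    · by_cases hC : LastJoined z.1
      · obtain ⟨k, hk, hkl⟩ := exists_of_lastJoined hn z hC
        have hki : k = i := by
          rcases NC.block_rel.1 (le_val hz.le hkl) with h | ⟨h | h | h, -⟩
          · exact absurd h (hk.trans hpl).ne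
          · exact absurd h (hk.trans hpl).ne
          · exact absurd h hk.ne
          · exact h
        subst hki
        exact absurd ((stemTop_le hn).2 ⟨hkl, hC⟩) (not_le_of_gt hz)
      · exact Or.inr (Subtype.ext (key z.1 (le_val hz.le) hC hA))

/-- If `x` does not join `n` to `n + 1`, every pair of elements joined in `x` is an atom below `x`,
so that `x` cannot have a single atom below it without being that atom. If it does, `x` is above
`stemTop i` for some `i`. -/
theorem exists_of_isStem (hn : 2 ≤ n) {b x : PosetPF n n} (h : IsStem b x) :
    ∃ i, ∃ hi : i < penult n, b = stemBot hn i hi ∧ x = stemTop hn i hi := by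
  obtain ⟨hb, hbx, hz⟩ := h
  have hpl := penult_lt_last (n := n) (by omega)
  by_cases hC : LastJoined x.1
  · obtain ⟨i, hi, hil⟩ := exists_of_lastJoined hn x hC
    have hst := isStem_stemBot_stemTop hn i hi
    have hle : stemTop hn i hi ≤ x := (stemTop_le hn).2 ⟨hil, hC⟩
    have hbi : b = stemBot hn i hi :=
      ((hz _ (hst.2.1.trans_le hle)).resolve_left hst.1).symm
    refine ⟨i, hi, hbi, ?_⟩
    by_contra hne
    rcases hz _ (lt_of_le_of_ne hle (Ne.symm hne)) with h | h
    · exact hst.1 (h.mono hst.2.1.le)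
    · rw [hbi] at h
      exact hst.2.1.ne' h
  · exfalso
    have hbC : ¬ LastJoined b.1 := fun h => hC (h.mono (le_val hbx.le))
    have hex : ∀ σ τ : NC (n + 1), ¬ σ ≤ τ → ∃ k l, k < l ∧ σ.1 k l ∧ ¬ τ.1 k l := by
      intro σ τ h
      by_contra! h'
      exact h (NC.le_of_lt h')
    have hnot_min : ∀ (a : PosetPF n n) (k l : Fin (n + 1)), k < l → a.1 = NC.block {k, l} →
        ¬ IsMin a := by
      intro a k l hkl ha hm
      have := (isMin_iff hn).1 hm
      rw [ha] at this
      exact hkl.ne (NC.bot_rel.1 (NC.block_pair_le.1 this.le))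
    obtain ⟨k, l, hkl, hb1, -⟩ := hex b.1 ⊥ fun h => hb ((isMin_iff hn).2 (le_bot_iff.1 h))
    obtain ⟨a, ha, hab⟩ := exists_pair hn hbC hb1
    have hab' : a = b := (hz a (hab.trans_lt hbx)).resolve_left (hnot_min a k l hkl ha)
    obtain ⟨k', l', hkl', hx1, hb2⟩ := hex x.1 b.1 fun h =>
      hbx.not_ge (le_of_not_lastJoined hn hbC h)
    obtain ⟨a', ha', hax⟩ := exists_pair hn hC hx1
    have hax' : a' = x := by
      by_contra hne
      rcases hz a' (lt_of_le_of_ne hax hne) with h | h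
      · exact hnot_min a' k' l' hkl' ha' h
      · rw [← h, ha'] at hb2
        exact hb2 (NC.block_pair_le.1 le_rfl)
    have hle := le_val hbx.le
    rw [← hab', ← hax', ha, ha'] at hle
    rw [← hab', ha] at hb2
    rcases NC.block_rel.1 (NC.block_pair_le.1 hle) with h | ⟨h1, h2⟩
    · exact hkl.ne h
    · apply hb2
      rcases h1 with rfl | rfl <;> rcases h2 with rfl | rfl
      · exact absurd hkl (lt_irrefl _)
      · exact NC.block_pair_le.1 le_rfl
      · exact absurd hkl (not_lt.2 hkl'.le)
      · exact absurd hkl (lt_irrefl _)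

theorem stemLT_iff (hn : 2 ≤ n) {i i' : Fin (n + 1)} (hi : i < penult n) (hi' : i' < penult n) :
    StemLT (stemBot hn i hi) (stemTop hn i hi) (stemBot hn i' hi') (stemTop hn i' hi') ↔
      i < i' := by
  have hn1 : 1 ≤ n := by omega
  constructor
  · rintro ⟨a, ⟨y, hby, hay, hxy⟩, hall⟩
    by_contra! hle
    rw [stemBot_le] at hby
    have hC : ¬ LastJoined y.1 := fun h => hxy ((stemTop_le hn).2 ⟨hby, h⟩)
    obtain ⟨m, hm0, hm, -, hym⟩ :=
      exists_le_splitAt hn1 (fun h => hC (lastJoined_of_rel hn y h)) hC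
    have hCm := not_lastJoined_splitAt hn1 hm
    have h1 : i' < m := hle.trans_lt ((splitAt_rel_last hi).1 (hym hby))
    have h2 := hall (split hn m hm0 hm) ((stemBot_le hn).2 ((splitAt_rel_last hi').2 h1))
      (hay.trans (le_of_not_lastJoined hn hCm hym))
    exact hCm ((stemTop_le hn).1 h2).2
  · intro hlt
    have hi0 : 0 < i' := (Fin.zero_le i).trans_lt hlt
    have hCm := not_lastJoined_splitAt hn1 hi'.le
    refine ⟨pair hn i' (penult n) hi' le_rfl fun h => hi0.ne' h.1,
      ⟨split hn i' hi0 hi'.le, (stemBot_le hn).2 ((splitAt_rel_last hi).2 hlt),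
        le_of_not_lastJoined hn hCm (NC.block_pair_le.2 (splitAt_rel_penult hn1 hi'.le)),
        fun h => hCm ((stemTop_le hn).1 h).2⟩, fun y h1 h2 => ?_⟩
    rw [stemBot_le] at h1
    exact (stemTop_le hn).2 ⟨h1, y.1.1.trans (y.1.1.symm (NC.block_pair_le.1 (le_val h2))) h1⟩

/-! ### Automorphisms -/

theorem exists_map_stem (hn : 2 ≤ n) (f : PosetPF n n ≃o PosetPF n n) (i : {i // i < penult n}) :
    ∃ k : {k // k < penult n}, f (stemBot hn i.1 i.2) = stemBot hn k.1 k.2 ∧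
      f (stemTop hn i.1 i.2) = stemTop hn k.1 k.2 := by
  obtain ⟨k, hk, h1, h2⟩ := exists_of_isStem hn ((isStem_stemBot_stemTop hn i.1 i.2).map f)
  exact ⟨⟨k, hk⟩, h1, h2⟩

/-- An automorphism permutes the pairs `(stemBot i, stemTop i)` and preserves the order of the
indices, and so fixes each of these pairs. -/
theorem map_stem (hn : 2 ≤ n) (f : PosetPF n n ≃o PosetPF n n) (i : Fin (n + 1))
    (hi : i < penult n) :
    f (stemBot hn i hi) = stemBot hn i hi ∧ f (stemTop hn i hi) = stemTop hn i hi := by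
  choose g hg1 hg2 using exists_map_stem hn f
  choose g' hg1' hg2' using exists_map_stem hn f.symm
  have hmono : StrictMono g := fun i j hij => by
    have := ((stemLT_iff hn i.2 j.2).2 hij).map f
    rw [hg1, hg2, hg1, hg2] at this
    exact (stemLT_iff hn _ _).1 this
  have hmono' : StrictMono g' := fun i j hij => by
    have := ((stemLT_iff hn i.2 j.2).2 hij).map f.symm
    rw [hg1', hg2', hg1', hg2'] at this
    exact (stemLT_iff hn _ _).1 this
  have hinv : ∀ i, g' (g i) = i := fun i => by
    have h := hg1' (g i)
    rw [← hg1, f.symm_apply_apply] at h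
    have h1 := (stemBot_le hn).1 h.ge
    have h2 := (stemBot_le hn).1 h.le
    have hpl := penult_lt_last (n := n) (by omega)
    rcases NC.block_rel.1 h2 with h3 | ⟨h3 | h3, -⟩
    · exact absurd h3 (i.2.trans hpl).ne
    · exact absurd h3 (i.2.trans hpl).ne
    · exact Subtype.ext h3.symm
  have hid : g ⟨i, hi⟩ = ⟨i, hi⟩ :=
    le_antisymm ((hmono'.le_apply (x := g ⟨i, hi⟩)).trans (hinv _).le) hmono.le_apply
  have h1 := hg1 ⟨i, hi⟩
  have h2 := hg2 ⟨i, hi⟩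
  rw [hid] at h1 h2
  exact ⟨h1, h2⟩

/-- The pairs `{i, j}` with `i < j < n` are fixed: `{i, j}` is below all common upper bounds of
`{i, n + 1}` and `{j, n + 1}`, in particular below `{i, j, n + 1}`. -/
theorem map_pair (hn : 2 ≤ n) (f : PosetPF n n ≃o PosetPF n n) {i j : Fin (n + 1)} (hij : i < j)
    (hj : j < penult n) (h0 : ¬ (i = 0 ∧ j = penult n)) :
    f (pair hn i j hij hj.le h0) = pair hn i j hij hj.le h0 := by
  have hpl := penult_lt_last (n := n) (by omega)
  have h0p := zero_lt_penult hn
  have hi := hij.trans hj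
  have key : ∀ f : PosetPF n n ≃o PosetPF n n,
      f (pair hn i j hij hj.le h0) ≤ pair hn i j hij hj.le h0 := by
    intro f
    have hpS : penult n ∉ ({Fin.last n, i, j} : Set (Fin (n + 1))) := by
      simp [hpl.ne, hi.ne', hj.ne']
    let t : PosetPF n n := ⟨NC.block {Fin.last n, i, j}, mem_of_not_lastJoined hn (fun h => by
      rcases NC.block_rel.1 h with h | h
      · exact h0p.ne h
      · exact hpS h.2) (NC.not_lastJoined_block hn (Or.inl hpS))⟩
    have ht : f (pair hn i j hij hj.le h0) ≤ t := by
      rw [← f.le_symm_apply, pair_le hn (hj := hj)]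
      have h1 : stemBot hn i hi ≤ f.symm t := by
        rw [f.le_symm_apply, (map_stem hn f i hi).1, stemBot_le]
        exact NC.block_rel.2 (by simp)
      have h2 : stemBot hn j hj ≤ f.symm t := by
        rw [f.le_symm_apply, (map_stem hn f j hj).1, stemBot_le]
        exact NC.block_rel.2 (by simp)
      rw [stemBot_le] at h1 h2
      exact (f.symm t).1.1.trans h1 ((f.symm t).1.1.symm h2)
    have hA : LastAlone (f (pair hn i j hij hj.le h0)).1 := by
      intro k hk
      by_contra hkl
      have hk' : k < penult n := by
        rcases NC.block_rel.1 (le_val ht hk) with h | ⟨h | h | h, -⟩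
        · exact absurd h hkl
        · exact absurd h hkl
        · exact h ▸ hi
        · exact h ▸ hj
      have h3 : stemBot hn k hk' ≤ pair hn i j hij hj.le h0 := by
        rw [← f.le_iff_le, (map_stem hn f k hk').1]
        exact (stemBot_le hn).2 hk
      rcases NC.block_rel.1 ((stemBot_le hn).1 h3) with h | ⟨-, h | h⟩
      · exact hkl h
      · exact (hi.trans hpl).ne' h
      · exact (hj.trans hpl).ne' h
    exact le_of_not_lastJoined hn (pair_not_lastJoined hn) (hA.le_block (le_val ht))
  refine le_antisymm (key f) ?_
  rw [← f.symm_apply_le]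
  exact key f.symm

/-- The pairs `{j, n}` with `1 < j < n` are fixed: the common upper bounds of `{j, n}` and
`{i, n + 1}` all join `n` to `n + 1` if and only if `j ≤ i`. -/
theorem map_pair_penult (hn : 2 ≤ n) (f : PosetPF n n ≃o PosetPF n n) {j : Fin (n + 1)}
    (hj : j < penult n) (h0 : ¬ (j = 0 ∧ penult n = penult n)) :
    f (pair hn j (penult n) hj le_rfl h0) = pair hn j (penult n) hj le_rfl h0 := by
  have hn1 : 1 ≤ n := by omega
  have hpl := penult_lt_last hn1
  have key : ∀ f : PosetPF n n ≃o PosetPF n n,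
      pair hn j (penult n) hj le_rfl h0 ≤ f (pair hn j (penult n) hj le_rfl h0) := by
    intro f
    set c := pair hn j (penult n) hj le_rfl h0 with hc
    have hcrel : ∀ y, c ≤ y → y.1.1 j (penult n) := fun y h => NC.block_pair_le.1 (le_val h)
    have hC : ¬ LastJoined (f c).1 := by
      intro hC
      obtain ⟨k, hk, hkl⟩ := exists_of_lastJoined hn _ hC
      have h3 : stemBot hn k hk ≤ c := by
        rw [← f.le_iff_le, (map_stem hn f k hk).1]
        exact (stemBot_le hn).2 hkl
      rcases NC.block_rel.1 ((stemBot_le hn).1 h3) with h | ⟨-, h | h⟩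
      · exact (hk.trans hpl).ne h
      · exact (hj.trans hpl).ne' h
      · exact hpl.ne' h
    obtain ⟨m, hm0, hm, hmp, hle⟩ :=
      exists_le_splitAt hn1 (fun h => hC (lastJoined_of_rel hn _ h)) hC
    have hj0 : 0 < j := Fin.pos_iff_ne_zero.2 fun h => h0 ⟨h, rfl⟩
    have hmj : m = j := by
      rcases lt_trichotomy m j with hlt | heq | hlt
      · exfalso
        have hCj := not_lastJoined_splitAt hn1 hj.le
        have hm' := hlt.trans hj
        have h1 : c ≤ split hn j hj0 hj.le :=
          le_of_not_lastJoined hn hCj (NC.block_pair_le.2 (splitAt_rel_penult hn1 hj.le))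
        have h2 : stemBot hn m hm' ≤ split hn j hj0 hj.le :=
          (stemBot_le hn).2 ((splitAt_rel_last hm').2 hlt)
        rw [← f.le_iff_le, (map_stem hn f m hm').1, stemBot_le] at h2
        have h3 : stemTop hn m hm' ≤ f (split hn j hj0 hj.le) := (stemTop_le hn).2 ⟨h2,
          Setoid.trans' _ (Setoid.symm' _ (le_val (f.le_iff_le.2 h1) hmp)) h2⟩
        rw [← (map_stem hn f m hm').2, f.le_iff_le] at h3
        exact hCj ((stemTop_le hn).1 h3).2
      · exact heq
      · exfalso
        have hCm := not_lastJoined_splitAt hn1 hm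
        have h1 : f c ≤ split hn m hm0 hm := le_of_not_lastJoined hn hCm hle
        have h2 : stemBot hn j hj ≤ split hn m hm0 hm :=
          (stemBot_le hn).2 ((splitAt_rel_last hj).2 hlt)
        rw [← (map_stem hn f j hj).1, ← f.le_symm_apply, stemBot_le] at h2
        have h3 : stemTop hn j hj ≤ f.symm (split hn m hm0 hm) := (stemTop_le hn).2 ⟨h2,
          Setoid.trans' _ (Setoid.symm' _ (hcrel _ (f.le_symm_apply.2 h1))) h2⟩
        rw [f.le_symm_apply, (map_stem hn f j hj).2] at h3
        exact hCm ((stemTop_le hn).1 h3).2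
    exact le_of_not_lastJoined hn hC (NC.block_pair_le.2 (hmj ▸ hmp))
  refine le_antisymm ?_ (key f)
  rw [← f.le_symm_apply]
  exact key f.symm

/-- Every pair of elements joined in `y` is witnessed by a fixed element `stemBot i`, `stemTop i`
or `pair i j` below `y`. -/
theorem val_le_map (hn : 2 ≤ n) (f : PosetPF n n ≃o PosetPF n n) (y : PosetPF n n) :
    y.1 ≤ (f y).1 := by
  have hpl := penult_lt_last (n := n) (by omega)
  have hbot : ∀ i < penult n, y.1.1 i (Fin.last n) → (f y).1.1 i (Fin.last n) := by
    intro i hi h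
    rw [← stemBot_le hn (hi := hi), ← f.le_iff_le, (map_stem hn f i hi).1] at h
    exact (stemBot_le hn).1 h
  have htop : ∀ i < penult n, y.1.1 i (Fin.last n) → LastJoined y.1 → LastJoined (f y).1 := by
    intro i hi h hC
    have h := (stemTop_le hn (hi := hi)).2 ⟨h, hC⟩
    rw [← f.le_iff_le, (map_stem hn f i hi).2] at h
    exact ((stemTop_le hn).1 h).2
  have hC' : LastJoined y.1 → LastJoined (f y).1 := fun hC => by
    obtain ⟨k, hk, hkl⟩ := exists_of_lastJoined hn y hC
    exact htop k hk hkl hC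
  refine NC.le_of_lt fun u v huv h => ?_
  rcases lt_penult_or v with hv | rfl | rfl
  · have h0 : ¬ (u = 0 ∧ v = penult n) := fun h => hv.ne h.2
    rw [← pair_le hn (hij := huv) (hj := hv) (h0 := h0), ← f.le_iff_le, map_pair hn f huv hv] at h
    exact (pair_le hn (hj := hv)).1 h
  · by_cases hC : LastJoined y.1
    · exact Setoid.trans' _ (hbot u huv (y.1.1.trans h hC)) (Setoid.symm' _ (hC' hC))
    · have h0 : ¬ (u = 0 ∧ penult n = penult n) := by
        rintro ⟨rfl, -⟩
        exact hC (lastJoined_of_rel hn y h)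
      have hle : pair hn u (penult n) huv le_rfl h0 ≤ y :=
        le_of_not_lastJoined hn hC (NC.block_pair_le.2 h)
      rw [← f.le_iff_le, map_pair_penult] at hle
      exact NC.block_pair_le.1 (le_val hle)
  · rcases lt_penult_or u with hu | rfl | rfl
    · exact hbot u hu h
    · exact hC' h
    · exact absurd huv (lt_irrefl _)

end PosetPF

end ParkingPoset

theorem mainTheorem6 (n : ℕ) (hn : 2 ≤ n)
    (f : ParkingPoset.PosetPF n n ≃o ParkingPoset.PosetPF n n) :
    f = OrderIso.refl (ParkingPoset.PosetPF n n) := by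
  ext y
  have h := ParkingPoset.PosetPF.val_le_map hn f.symm (f y)
  rw [f.symm_apply_apply] at h
  exact Subtype.ext (le_antisymm h (ParkingPoset.PosetPF.val_le_map hn f y))
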